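/- Let $L$ be a $\sigma$-orthocomplete orthomodular poset, i.e. a poset with least element $0$ and greatest element $1$ and a map $a\mapsto a^\perp$ such that $a^{\perp\perp}=a$; $a\le b$ implies $b^\perp\le a^\perp$; $a\vee b$ exists whenever $a\le b^\perp$; $a\vee a^\perp=1$; $a\le b$ implies $b=a\vee(a\vee b^\perp)^\perp$; and $\bigvee_n a_n$ exists for every sequence $(a_n)$ with $a_n\le a_m^\perp$ for $n\neq m$. An *observable* on $L$ is a map $x$ from the Borel $\sigma$-algebra $\mathcal B(\mathbb R)$ to $L$ such that (i) $x(\mathbb R)=1$; (ii) if $E\cap F=\emptyset$, then $x(E)\le x(F)^\perp$ and $x(E\cup F)=x(E)\vee x(F)$; (iii) if $E_1\subseteq E_2\subseteq\cdots$, then $x(\bigcup_iE_i)=\bigvee_i x(E_i)$. A map $x:\mathcal B(\mathbb R)\to L$ is a *$\sigma$-homomorphism of Boolean algebras* if its values lie in a Boolean $\sigma$-algebra $M\subseteq L$ (a subset containing $1$, closed under $^\perp$ and under joins of sequences, which exist in $L$, and distributive, with the joins and meets of $L$), and $x$ preserves $0$, $1$, complements, and countable joins and meets: $x(\emptyset)=0$,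 $x(\mathbb R)=1$, $x(\mathbb R\setminus E)=x(E)^\perp$, and $x(\bigcup_iE_i)=\bigvee_i x(E_i)$, $x(\bigcap_iE_i)=\bigwedge_i x(E_i)$ for every sequence $(E_i)$ of Borel sets. Theorem. Let $\{x_t:t\in\mathbb R\}$ be a system of elements of $L$ such that - $x_t\le x_s$ if $t<s$, - $\bigwedge_t x_t=0$ and $\bigvee_t x_t=1$, - $\bigvee_{t<s}x_t=x_s$ for every $s\in\mathbb R$ (the existence of these meets and joins in $L$ being part of the hypothesis). Then there is a unique observable $x$ on $L$ such that $x((-\infty,t))=x_t$ for every $t\in\mathbb R$, and this $x$ is a $\sigma$-homomorphism of Boolean algebras. Moreover, every observable on $L$ is a $\sigma$-homomorphism of Boolean algebras. -/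

import Mathlib

/-- An orthomodular poset: a bounded poset with an orthocomplementation `ᶜ` (an order-reversing
involution such that orthogonal elements have a join and `a ∨ aᶜ = 1`) that satisfies the
orthomodular law `b = a ∨ (a ∨ bᶜ)ᶜ` for `a ≤ b`.  Joins are only partially defined, so they are
expressed by `IsLUB`. -/
class OrthomodularPoset (L : Type*) extends PartialOrder L, BoundedOrder L, Compl L where
  compl_compl' : ∀ a : L, aᶜᶜ = a
  compl_anti' : ∀ a b : L, a ≤ b → bᶜ ≤ aᶜ
  exists_isLUB_of_orthogonal' : ∀ a b : L, a ≤ bᶜ → ∃ c : L, IsLUB {a, b} c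
  isLUB_compl_top' : ∀ a : L, IsLUB {a, aᶜ} ⊤
  orthomodular' : ∀ a b c : L, a ≤ b → IsLUB {a, bᶜ} c → IsLUB {a, cᶜ} b

/-- Every sequence of mutually orthogonal elements has a join. -/
def IsSigmaOrthocomplete (L : Type*) [OrthomodularPoset L] : Prop :=
  ∀ a : ℕ → L, (∀ n m, n ≠ m → a n ≤ (a m)ᶜ) → ∃ s : L, IsLUB (Set.range a) s

/-- The partial addition of the effect algebra attached to an orthomodular poset: `a + b` is
defined and equal to `c` iff `a ≤ bᶜ` and `c = a ∨ b`. -/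
def IsOrthoSum {L : Type*} [OrthomodularPoset L] (a b c : L) : Prop :=
  a ≤ bᶜ ∧ IsLUB {a, b} c

/-- The Borel subsets of the real line. -/
abbrev BorelSet : Type := {E : Set ℝ // MeasurableSet E}

/-- The Borel set `(-∞, t)`. -/
def BorelSet.Iio (t : ℝ) : BorelSet := ⟨Set.Iio t, measurableSet_Iio⟩

/-- The union of a sequence of Borel sets. -/
def BorelSet.iUnion (E : ℕ → BorelSet) : BorelSet :=
  ⟨⋃ n, (E n : Set ℝ), MeasurableSet.iUnion fun n => (E n).2⟩

/-- The intersection of a sequence of Borel sets. -/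
def BorelSet.iInter (E : ℕ → BorelSet) : BorelSet :=
  ⟨⋂ n, (E n : Set ℝ), MeasurableSet.iInter fun n => (E n).2⟩

/-- An observable: a map from the Borel sets to `L` that is unital, additive on disjoint sets for
the partial addition of `L`, and continuous along increasing sequences. -/
structure IsObservable {L : Type*} [OrthomodularPoset L] (x : BorelSet → L) : Prop where
  map_univ : x ⟨Set.univ, MeasurableSet.univ⟩ = ⊤
  map_union : ∀ E F : BorelSet, Disjoint (E : Set ℝ) (F : Set ℝ) →
    IsOrthoSum (x E) (x F) (x ⟨(E : Set ℝ) ∪ (F : Set ℝ), E.2.union F.2⟩)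
  map_iUnion : ∀ E : ℕ → BorelSet, (∀ i, (E i : Set ℝ) ⊆ (E (i + 1) : Set ℝ)) →
    IsLUB (Set.range fun i => x (E i)) (x (BorelSet.iUnion E))

/-- `M` is a Boolean `σ`-algebra in `L`: a set containing `1`, closed under orthocomplements and
under joins of sequences (which exist in `L`; meets follow by complementation), and distributive
for the joins and meets of `L`. -/
structure IsBooleanSigmaSubalgebra {L : Type*} [OrthomodularPoset L] (M : Set L) : Prop where
  top_mem : (⊤ : L) ∈ M
  compl_mem : ∀ a ∈ M, aᶜ ∈ M
  exists_isLUB : ∀ a : ℕ → L, (∀ n, a n ∈ M) → ∃ s ∈ M, IsLUB (Set.range a) s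
  distrib : ∀ a ∈ M, ∀ b ∈ M, ∀ c ∈ M, ∀ j m p q : L,
    IsLUB {b, c} j → IsGLB {a, j} m → IsGLB {a, b} p → IsGLB {a, c} q → IsLUB {p, q} m

/-- A `σ`-homomorphism of Boolean algebras from the Borel sets into `L`: it takes values in a
Boolean `σ`-algebra in `L` and preserves `0`, `1`, complements, and arbitrary countable unions and
intersections (joins and meets being those of `L`). -/
structure IsBooleanSigmaHom {L : Type*} [OrthomodularPoset L] (x : BorelSet → L) : Prop where
  exists_subalgebra : ∃ M : Set L, IsBooleanSigmaSubalgebra M ∧ ∀ E : BorelSet, x E ∈ M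
  map_empty : x ⟨∅, MeasurableSet.empty⟩ = ⊥
  map_univ : x ⟨Set.univ, MeasurableSet.univ⟩ = ⊤
  map_compl : ∀ E : BorelSet, x ⟨(E : Set ℝ)ᶜ, E.2.compl⟩ = (x E)ᶜ
  map_iUnion : ∀ E : ℕ → BorelSet,
    IsLUB (Set.range fun i => x (E i)) (x (BorelSet.iUnion E))
  map_iInter : ∀ E : ℕ → BorelSet,
    IsGLB (Set.range fun i => x (E i)) (x (BorelSet.iInter E))

/-- A system `{x_t : t ∈ ℝ}` that is monotone, has meet `0` and join `1`, and satisfies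
`⋁_{t < s} x_t = x_s` for every real `s`. -/
structure IsSpectralSystem {L : Type*} [OrthomodularPoset L] (X : ℝ → L) : Prop where
  mono : ∀ t s : ℝ, t < s → X t ≤ X s
  isGLB_bot : IsGLB (Set.range X) ⊥
  isLUB_top : IsLUB (Set.range X) ⊤
  isLUB_left : ∀ s : ℝ, IsLUB (X '' Set.Iio s) (X s)

/-! ### Orthomodular arithmetic, compatibility and Boolean subalgebras. -/

section OrthomodularPoset

variable {L : Type*} [OrthomodularPoset L]

namespace OrthomodularPoset

/-! The system `X` is a chain, and by Zorn a chain lies in a Boolean subalgebra `M` of `L`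
containing every element compatible with all of `M` (`exists_isBooleanSubalgebra_of_chain`).
Compatibility passes to countable orthogonal joins, so `M` is closed under them
(`IsBooleanSubalgebra.isLUB_mem`).

The extension of `X` to Borel sets is by forcing. A decreasing sequence of nonzero elements that
meets countably many suitable dense sets determines a real `r`, the infimum of the rationals `q`
with `X q` forced. A Borel set `E` is represented by `m ∈ M` if, for all sufficiently generic
sequences, `r ∈ E` iff `m` is forced. Half-lines are represented by the `X t`, and representability
survives complements and disjoint countable unions, so every Borel set is represented. By
Rasiowa–Sikorski a generic sequence starts at any nonzero element of `M`, so disjoint sets have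
orthogonal representatives (`orthogonal_of_represents`). Hence representatives are unique, and
sending `E` to its representative is an observable.

It is the only one because half-lines generate the Borel sets. Any observable turns countable set
operations into joins and meets of `L`, so its range inherits distributivity from sets. -/

theorem isLUB_pair_iff {a b c : L} : IsLUB {a, b} c ↔ ∀ u, c ≤ u ↔ a ≤ u ∧ b ≤ u := by
  rw [isLUB_iff_le_iff]
  simp [upperBounds]

theorem le_compl_comm {a b : L} : a ≤ bᶜ ↔ b ≤ aᶜ := by
  constructor <;> intro h
  · have := compl_anti' _ _ h
    rwa [compl_compl'] at this
  · have := compl_anti' _ _ h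
    rwa [compl_compl'] at this

theorem compl_le_comm {a b : L} : aᶜ ≤ b ↔ bᶜ ≤ a := by
  constructor <;> intro h
  · have := compl_anti' _ _ h
    rwa [compl_compl'] at this
  · have := compl_anti' _ _ h
    rwa [compl_compl'] at this

theorem compl_le_compl_iff' {a b : L} : aᶜ ≤ bᶜ ↔ b ≤ a := by
  rw [le_compl_comm, compl_compl']

theorem compl_bot' : (⊥ : L)ᶜ = ⊤ := by
  have h := isLUB_pair_iff.1 (isLUB_compl_top' (⊥ : L))
  exact top_le_iff.1 ((h _).2 ⟨bot_le, le_rfl⟩)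

theorem compl_top' : (⊤ : L)ᶜ = ⊥ := by
  rw [← compl_bot', compl_compl']

theorem eq_bot_of_le_compl {a : L} (h : a ≤ aᶜ) : a = ⊥ := by
  have h1 := isLUB_pair_iff.1 (isLUB_compl_top' a)
  have h2 : aᶜ = ⊤ := top_le_iff.1 ((h1 _).2 ⟨h, le_rfl⟩)
  rw [← compl_compl' a, h2, compl_top']

theorem eq_bot_of_le_of_le_compl {a b : L} (h : a ≤ b) (h' : a ≤ bᶜ) : a = ⊥ :=
  eq_bot_of_le_compl (h'.trans (compl_anti' _ _ h))

/-- The relative complement of `a` in `b`, realised as `(a ∨ bᶜ)ᶜ`; the orthomodular law is used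
only in this form. -/
theorem exists_diff {a b : L} (h : a ≤ b) : ∃ d, d ≤ aᶜ ∧ IsLUB {a, d} b := by
  obtain ⟨c, hc⟩ := exists_isLUB_of_orthogonal' a bᶜ (by rwa [compl_compl'])
  exact ⟨cᶜ, compl_anti' _ _ (((isLUB_pair_iff.1 hc c).1 le_rfl).1), orthomodular' a b c h hc⟩

/-- The summand `p` of `a = p ⊕ q` is the largest element below `a` and orthogonal to `q`. -/
theorem le_of_le_of_orthogonal {a p q z : L} (h : IsLUB {p, q} a) (hpq : p ≤ qᶜ) (hz : z ≤ a)
    (hzq : z ≤ qᶜ) : z ≤ p := by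
  have h := isLUB_pair_iff.1 h
  obtain ⟨hpa, hqa⟩ := (h a).1 le_rfl
  -- Here `cᶜ` is `a ∧ qᶜ`, which lies above both `z` and `p`. What is left of `cᶜ` after removing
  -- `p` is below `a` and orthogonal to `p` and `q`, hence zero.
  obtain ⟨c, hc⟩ := exists_isLUB_of_orthogonal' q aᶜ (by rwa [compl_compl'])
  have hc := isLUB_pair_iff.1 hc
  obtain ⟨hqc, hac⟩ := (hc c).1 le_rfl
  have hzc : z ≤ cᶜ := le_compl_comm.1 ((hc _).2 ⟨le_compl_comm.1 hzq, compl_anti' _ _ hz⟩)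
  have hpc : p ≤ cᶜ := le_compl_comm.1 ((hc _).2 ⟨le_compl_comm.1 hpq, compl_anti' _ _ hpa⟩)
  obtain ⟨e, hep, he⟩ := exists_diff hpc
  have he := isLUB_pair_iff.1 he
  have hec : e ≤ cᶜ := ((he _).1 le_rfl).2
  have hea : e ≤ a := hec.trans (compl_le_comm.1 hac)
  have hae : a ≤ eᶜ :=
    (h _).2 ⟨le_compl_comm.1 hep, le_compl_comm.1 (hec.trans (compl_anti' _ _ hqc))⟩
  have : e = ⊥ := eq_bot_of_le_compl (hea.trans hae)
  exact hzc.trans ((he p).2 ⟨le_rfl, this ▸ bot_le⟩)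

theorem eq_compl_of_isLUB_top {a b : L} (hab : a ≤ bᶜ) (h : IsLUB {a, b} ⊤) : aᶜ = b := by
  refine le_antisymm ?_ (le_compl_comm.1 hab)
  rw [Set.pair_comm] at h
  exact le_of_le_of_orthogonal h (le_compl_comm.1 hab) le_top le_rfl

/-- `a` is the join of `p ≤ b` and `q ≤ bᶜ`; then `p = a ∧ b` and `q = a ∧ bᶜ`. -/
structure Splits (a b p q : L) : Prop where
  le_left : p ≤ b
  le_right : q ≤ bᶜ
  isLUB : IsLUB {p, q} a

namespace Splits

variable {a b p q z : L}

theorem orthogonal (h : Splits a b p q) : p ≤ qᶜ :=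
  h.le_left.trans (le_compl_comm.1 h.le_right)

theorem le_iff (h : Splits a b p q) (u : L) : a ≤ u ↔ p ≤ u ∧ q ≤ u :=
  isLUB_pair_iff.1 h.isLUB u

theorem left_le (h : Splits a b p q) : p ≤ a := ((h.le_iff a).1 le_rfl).1

theorem right_le (h : Splits a b p q) : q ≤ a := ((h.le_iff a).1 le_rfl).2

theorem compl_right (h : Splits a b p q) : Splits a bᶜ q p :=
  ⟨h.le_right, by rw [compl_compl']; exact h.le_left, by rw [Set.pair_comm]; exact h.isLUB⟩

theorem le_inf (h : Splits a b p q) (hza : z ≤ a) (hzb : z ≤ b) : z ≤ p :=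
  le_of_le_of_orthogonal h.isLUB h.orthogonal hza (hzb.trans (le_compl_comm.1 h.le_right))

theorem le_compl_of_orthogonal (h : Splits a b p q) (hza : z ≤ a) (hzp : z ≤ pᶜ) : z ≤ bᶜ := by
  refine le_trans ?_ h.le_right
  refine le_of_le_of_orthogonal h.compl_right.isLUB h.compl_right.orthogonal hza hzp

/-- The rest `r` of `b` outside `p` is orthogonal to `p` by choice and to `q` because `r ≤ b`, hence
to `a`. -/
theorem symm (h : Splits a b p q) : ∃ r, Splits b a p r := by
  obtain ⟨r, hr, hb⟩ := exists_diff h.le_left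
  refine ⟨r, h.left_le, le_compl_comm.1 ((h.le_iff _).2 ⟨le_compl_comm.1 hr, ?_⟩), hb⟩
  exact h.le_right.trans (compl_anti' _ _ ((isLUB_pair_iff.1 hb b).1 le_rfl).2)

/-- Meeting with a fixed element is additive. -/
theorem isLUB_inf {s x y p₁ y₁ q₁ y₂ : L} (hb : Splits b s x y) (hp : Splits p s p₁ y₁)
    (hq : Splits q s q₁ y₂) (hpq : p ≤ qᶜ) (h : IsLUB {p, q} b) : IsLUB {p₁, q₁} x := by
  have h := isLUB_pair_iff.1 h
  obtain ⟨hpb, hqb⟩ := (h b).1 le_rfl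
  have hpx : p₁ ≤ x := hb.le_inf (hp.left_le.trans hpb) hp.le_left
  have hqx : q₁ ≤ x := hb.le_inf (hq.left_le.trans hqb) hq.le_left
  obtain ⟨j, hj⟩ := exists_isLUB_of_orthogonal' p₁ q₁
    (hp.left_le.trans (hpq.trans (compl_anti' _ _ hq.left_le)))
  have hj' := isLUB_pair_iff.1 hj
  obtain ⟨hpj, hqj⟩ := (hj' j).1 le_rfl
  have hjx : j ≤ x := (hj' x).2 ⟨hpx, hqx⟩
  -- The defect `r` of `x` over `j` lies below `s` and is orthogonal to `p ∧ s` and `q ∧ s`, hence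
  -- to `p` and `q`, hence to `b`; but `r ≤ b`.
  obtain ⟨r, hrj, hr⟩ := exists_diff hjx
  have hr := isLUB_pair_iff.1 hr
  have hrx : r ≤ x := ((hr x).1 le_rfl).2
  have hrs : r ≤ s := hrx.trans hb.le_left
  obtain ⟨_, hsp⟩ := hp.symm
  obtain ⟨_, hsq⟩ := hq.symm
  have hrp : r ≤ pᶜ := hsp.le_compl_of_orthogonal hrs (hrj.trans (compl_anti' _ _ hpj))
  have hrq : r ≤ qᶜ := hsq.le_compl_of_orthogonal hrs (hrj.trans (compl_anti' _ _ hqj))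
  have hr0 : r = ⊥ := eq_bot_of_le_of_le_compl (hrx.trans hb.left_le)
    (le_compl_comm.1 ((h _).2 ⟨le_compl_comm.1 hrp, le_compl_comm.1 hrq⟩))
  have : x = j := le_antisymm ((hr j).2 ⟨le_rfl, hr0 ▸ bot_le⟩) hjx
  rwa [this]

end Splits

/-- Compatibility of two elements. -/
def Compatible (a b : L) : Prop := ∃ p q, Splits a b p q

namespace Compatible

variable {a b c s t : L}

theorem symm (h : Compatible a b) : Compatible b a := by
  obtain ⟨p, q, h⟩ := h
  obtain ⟨r, hr⟩ := h.symm
  exact ⟨p, r, hr⟩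

theorem compl_right (h : Compatible a b) : Compatible a bᶜ := by
  obtain ⟨p, q, h⟩ := h
  exact ⟨q, p, h.compl_right⟩

theorem of_le (h : a ≤ b) : Compatible a b :=
  ⟨a, ⊥, h, bot_le, isLUB_pair_iff.2 fun u => by simp⟩

theorem of_isLUB (ha : Compatible a s) (hb : Compatible b s) (hab : a ≤ bᶜ)
    (h : IsLUB {a, b} c) : Compatible c s := by
  obtain ⟨p, q, hpq⟩ := ha
  obtain ⟨p', q', hpq'⟩ := hb
  have h := isLUB_pair_iff.1 h
  obtain ⟨j, hj⟩ := exists_isLUB_of_orthogonal' p p'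
    (hpq.left_le.trans (hab.trans (compl_anti' _ _ hpq'.left_le)))
  obtain ⟨k, hk⟩ := exists_isLUB_of_orthogonal' q q'
    (hpq.right_le.trans (hab.trans (compl_anti' _ _ hpq'.right_le)))
  rw [isLUB_pair_iff] at hj hk
  refine ⟨j, k, (hj _).2 ⟨hpq.le_left, hpq'.le_left⟩, (hk _).2 ⟨hpq.le_right, hpq'.le_right⟩,
    isLUB_pair_iff.2 fun u => ?_⟩
  rw [h, hpq.le_iff, hpq'.le_iff, hj, hk]
  tauto

/-- If `c` is compatible with `s ≤ t`, then `c ∧ sᶜ` is compatible with `t`. -/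
theorem of_splits_of_le {p q : L} (hst : s ≤ t) (hs : Splits c s p q) (ht : Compatible c t) :
    Compatible q t := by
  obtain ⟨u, v, ht⟩ := ht
  have hpu : p ≤ u := ht.le_inf hs.left_le (hs.le_left.trans hst)
  -- With `u = c ∧ t` and `v = c ∧ tᶜ`, the claim is that `q` is the join of `d ≤ t` and `v ≤ tᶜ`.
  -- It follows by cancelling `p` from `c = p ∨ d ∨ v`.
  obtain ⟨d, hdp, hd⟩ := exists_diff hpu
  have hd' := isLUB_pair_iff.1 hd
  have hdu : d ≤ u := ((hd' u).1 le_rfl).2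
  have hdt : d ≤ t := hdu.trans ht.le_left
  have hdq : d ≤ q := by
    have h := hs.compl_right
    exact le_of_le_of_orthogonal h.isLUB h.orthogonal (hdu.trans ht.left_le) hdp
  have hvq : v ≤ q := hs.compl_right.le_inf ht.right_le (ht.le_right.trans (compl_anti' _ _ hst))
  obtain ⟨j, hj⟩ := exists_isLUB_of_orthogonal' d v
    (hdt.trans (le_compl_comm.1 ht.le_right))
  have hj' := isLUB_pair_iff.1 hj
  have hjq : j ≤ q := (hj' q).2 ⟨hdq, hvq⟩
  have hqj : q ≤ j := by
    obtain ⟨hdj, hvj⟩ := (hj' j).1 le_rfl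
    refine le_of_le_of_orthogonal (a := c) (q := p) ?_ (hjq.trans hs.compl_right.orthogonal)
      hs.right_le hs.compl_right.orthogonal
    refine isLUB_pair_iff.2 fun w => ?_
    rw [ht.le_iff, hd', hj']
    tauto
  exact ⟨d, v, hdt, ht.le_right, le_antisymm hjq hqj ▸ hj⟩

end Compatible

/-- A set is a Boolean subalgebra if it contains `⊤` and is closed under complements and under
splitting one element by another. -/
structure IsBooleanSubalgebra (M : Set L) : Prop where
  top_mem : ⊤ ∈ M
  compl_mem : ∀ a ∈ M, aᶜ ∈ M
  splits : ∀ a ∈ M, ∀ b ∈ M, ∃ p ∈ M, ∃ q ∈ M, Splits a b p q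

theorem isBooleanSubalgebra_bot_top : IsBooleanSubalgebra ({⊥, ⊤} : Set L) where
  top_mem := by simp
  compl_mem := by
    rintro a (rfl | rfl)
    · simp [compl_bot']
    · simp [compl_top']
  splits := by
    rintro a ha b (rfl | rfl)
    · exact ⟨⊥, by simp, a, ha, le_rfl, by simp [compl_bot'], isLUB_pair_iff.2 fun u => by simp⟩
    · exact ⟨a, ha, ⊥, by simp, le_top, bot_le, isLUB_pair_iff.2 fun u => by simp⟩

theorem IsBooleanSubalgebra.sUnion {c : Set (Set L)} (hc : IsChain (· ⊆ ·) c) (hne : c.Nonempty)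
    (h : ∀ M ∈ c, IsBooleanSubalgebra M) : IsBooleanSubalgebra (⋃₀ c) where
  top_mem := by
    obtain ⟨M, hM⟩ := hne
    exact ⟨M, hM, (h M hM).top_mem⟩
  compl_mem := by
    rintro a ⟨M, hM, ha⟩
    exact ⟨M, hM, (h M hM).compl_mem a ha⟩
  splits := by
    rintro a ⟨M, hM, ha⟩ b ⟨N, hN, hb⟩
    obtain ⟨K, hK, haK, hbK⟩ : ∃ K ∈ c, a ∈ K ∧ b ∈ K := by
      rcases hc.total hM hN with hle | hle
      · exact ⟨N, hN, hle ha, hb⟩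
      · exact ⟨M, hM, ha, hle hb⟩
    obtain ⟨p, hp, q, hq, hs⟩ := (h K hK).splits a haK b hbK
    exact ⟨p, ⟨K, hK, hp⟩, q, ⟨K, hK, hq⟩, hs⟩

/-- Adjoining an element that is compatible with a Boolean subalgebra. -/
theorem IsBooleanSubalgebra.exists_adjoin {M : Set L} (hM : IsBooleanSubalgebra M) {s : L}
    (hs : ∀ b ∈ M, Compatible b s) :
    ∃ N, IsBooleanSubalgebra N ∧ M ⊆ N ∧ s ∈ N ∧
      ∀ z ∈ N, ∃ b ∈ M, ∃ c ∈ M, ∃ p q p' q',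
        Splits b s p q ∧ Splits c s p' q' ∧ IsLUB {p, q'} z := by
  choose! σ τ h using hs
  have orth : ∀ b ∈ M, ∀ c ∈ M, σ b ≤ (τ c)ᶜ := fun b hb c hc =>
    (h b hb).le_left.trans (le_compl_comm.1 (h c hc).le_right)
  have bot_mem : ⊥ ∈ M := by
    rw [← compl_top']
    exact hM.compl_mem _ hM.top_mem
  have σ_top : σ ⊤ = s := le_antisymm (h ⊤ hM.top_mem).le_left
    ((h ⊤ hM.top_mem).le_inf le_top le_rfl)
  have τ_top : τ ⊤ = sᶜ := le_antisymm (h ⊤ hM.top_mem).le_right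
    ((h ⊤ hM.top_mem).compl_right.le_inf le_top le_rfl)
  have τ_bot : τ ⊥ = ⊥ := le_bot_iff.1 (h ⊥ bot_mem).right_le
  have self_compl : ∀ b : L, IsLUB {b, bᶜ} ⊤ := isLUB_compl_top'
  -- The elements `(b ∧ s) ∨ (c ∧ sᶜ)`; complements and splittings are computed on `b` and `c`
  -- separately.
  refine ⟨{z | ∃ b ∈ M, ∃ c ∈ M, IsLUB {σ b, τ c} z}, ⟨?_, ?_, ?_⟩, ?_, ?_, ?_⟩
  · exact ⟨⊤, hM.top_mem, ⊤, hM.top_mem, (h ⊤ hM.top_mem).isLUB⟩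
  · rintro z ⟨b, hb, c, hc, hz⟩
    have hb' := hM.compl_mem b hb
    have hc' := hM.compl_mem c hc
    have h1 := isLUB_pair_iff.1 ((h ⊤ hM.top_mem).isLUB_inf (h b hb) (h _ hb')
      (by rw [compl_compl']) (self_compl b))
    have h2 := isLUB_pair_iff.1 ((h ⊤ hM.top_mem).compl_right.isLUB_inf (h c hc).compl_right
      (h _ hc').compl_right (by rw [compl_compl']) (self_compl c))
    have hz := isLUB_pair_iff.1 hz
    obtain ⟨w, hw⟩ := exists_isLUB_of_orthogonal' _ _ (orth _ hb' _ hc')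
    have hw' := isLUB_pair_iff.1 hw
    refine ⟨bᶜ, hb', cᶜ, hc', ?_⟩
    suffices zᶜ = w by rwa [this]
    apply eq_compl_of_isLUB_top
    · refine (hz _).2 ⟨le_compl_comm.1 ((hw' _).2 ⟨?_, ?_⟩), le_compl_comm.1 ((hw' _).2 ⟨?_, ?_⟩)⟩
      · exact (h _ hb').left_le.trans (compl_anti' _ _ (h b hb).left_le)
      · exact le_compl_comm.1 (orth _ hb _ hc')
      · exact orth _ hb' _ hc
      · exact (h _ hc').right_le.trans (compl_anti' _ _ (h c hc).right_le)
    · refine isLUB_pair_iff.2 fun u => ?_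
      rw [(h ⊤ hM.top_mem).le_iff, h1, h2, hz, hw']
      tauto
  · rintro z ⟨b, hb, c, hc, hz⟩ w ⟨b', hb', c', hc', hw⟩
    obtain ⟨b₁, hb₁, b₂, hb₂, hbs⟩ := hM.splits b hb b' hb'
    obtain ⟨c₁, hc₁, c₂, hc₂, hcs⟩ := hM.splits c hc c' hc'
    have h1 := isLUB_pair_iff.1 ((h b hb).isLUB_inf (h _ hb₁) (h _ hb₂) hbs.orthogonal hbs.isLUB)
    have h2 := isLUB_pair_iff.1 ((h c hc).compl_right.isLUB_inf (h _ hc₁).compl_right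
      (h _ hc₂).compl_right hcs.orthogonal hcs.isLUB)
    obtain ⟨p, hp⟩ := exists_isLUB_of_orthogonal' _ _ (orth _ hb₁ _ hc₁)
    obtain ⟨q, hq⟩ := exists_isLUB_of_orthogonal' _ _ (orth _ hb₂ _ hc₂)
    refine ⟨p, ⟨b₁, hb₁, c₁, hc₁, hp⟩, q, ⟨b₂, hb₂, c₂, hc₂, hq⟩, ?_⟩
    rw [isLUB_pair_iff] at hz hw hp hq
    obtain ⟨hwσ, hwτ⟩ := (hw w).1 le_rfl
    refine ⟨(hp _).2 ⟨le_trans ?_ hwσ, le_trans ?_ hwτ⟩, (hq _).2 ⟨le_compl_comm.1 ((hw _).2 ⟨?_, ?_⟩),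
      le_compl_comm.1 ((hw _).2 ⟨?_, ?_⟩)⟩, isLUB_pair_iff.2 fun u => ?_⟩
    · exact (h _ hb').le_inf ((h _ hb₁).left_le.trans hbs.le_left) (h _ hb₁).le_left
    · exact (h _ hc').compl_right.le_inf ((h _ hc₁).right_le.trans hcs.le_left) (h _ hc₁).le_right
    · exact le_compl_comm.1 ((h _ hb₂).left_le.trans
        (hbs.le_right.trans (compl_anti' _ _ (h _ hb').left_le)))
    · exact le_compl_comm.1 (orth _ hb₂ _ hc')
    · exact orth _ hb' _ hc₂
    · exact le_compl_comm.1 ((h _ hc₂).right_le.trans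
        (hcs.le_right.trans (compl_anti' _ _ (h _ hc').right_le)))
    · rw [hz, h1, h2, hp, hq]
      tauto
  · exact fun b hb => ⟨b, hb, b, hb, (h b hb).isLUB⟩
  · refine ⟨⊤, hM.top_mem, ⊥, bot_mem, isLUB_pair_iff.2 fun u => ?_⟩
    simp [σ_top, τ_bot]
  · rintro z ⟨b, hb, c, hc, hz⟩
    exact ⟨b, hb, c, hc, _, _, _, _, h b hb, h c hc, hz⟩

/-- A chain is contained in a Boolean subalgebra containing every element compatible with it. -/
theorem exists_isBooleanSubalgebra_of_chain {ι : Type*} [LinearOrder ι] {X : ι → L}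
    (hX : Monotone X) :
    ∃ M, IsBooleanSubalgebra M ∧ (∀ t, X t ∈ M) ∧ ∀ s, (∀ b ∈ M, Compatible b s) → s ∈ M := by
  -- Zorn runs over the Boolean subalgebras compatible with the chain; that a maximal one contains
  -- the chain is proved afterwards by adjoining each `X s`.
  obtain ⟨M, -, hM⟩ := zorn_subset_nonempty
    {M : Set L | IsBooleanSubalgebra M ∧ ∀ b ∈ M, ∀ t, Compatible b (X t)} (by
      intro c hc hch hne
      refine ⟨⋃₀ c, ⟨.sUnion hch hne fun M hM => (hc hM).1, ?_⟩, fun M hM => Set.subset_sUnion_of_mem hM⟩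
      rintro b ⟨M, hM, hb⟩ t
      exact (hc hM).2 b hb t) {⊥, ⊤} ⟨isBooleanSubalgebra_bot_top, by
        rintro b (rfl | rfl) t
        · exact .of_le bot_le
        · exact (Compatible.of_le le_top).symm⟩
  have mem_of : ∀ s, ∀ N, IsBooleanSubalgebra N → (∀ b ∈ N, ∀ t, Compatible b (X t)) →
      M ⊆ N → s ∈ N → s ∈ M := fun s N hN hNX hMN hs => hM.le_of_ge ⟨hN, hNX⟩ hMN hs
  have hXM : ∀ t, X t ∈ M := by
    intro s
    obtain ⟨N, hN, hMN, hsN, hNs⟩ := hM.prop.1.exists_adjoin fun b hb => hM.prop.2 b hb s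
    refine mem_of _ N hN (fun z hz t => ?_) hMN hsN
    obtain ⟨b, hb, c, hc, p, q, p', q', hbs, hcs, hz⟩ := hNs z hz
    have hpq : p ≤ q'ᶜ := hbs.le_left.trans (le_compl_comm.1 hcs.le_right)
    -- One of the two pieces is comparable with `X t` or its complement; the other is handled by
    -- `of_splits_of_le`, in complemented form when `t ≤ s`.
    have key : Compatible p (X t) ∧ Compatible q' (X t) := by
      rcases le_total s t with hst | hst
      · exact ⟨.of_le (hbs.le_left.trans (hX hst)),
          .of_splits_of_le (hX hst) hcs (hM.prop.2 c hc t)⟩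
      · have hst' := compl_anti' _ _ (hX hst)
        constructor
        · have := (Compatible.of_splits_of_le hst' hbs.compl_right
            (hM.prop.2 b hb t).compl_right).compl_right
          rwa [compl_compl'] at this
        · have := (Compatible.of_le (hcs.le_right.trans hst')).compl_right
          rwa [compl_compl'] at this
    exact key.1.of_isLUB key.2 hpq hz
  refine ⟨M, hM.prop.1, hXM, fun s hs => ?_⟩
  obtain ⟨N, hN, hMN, hsN, -⟩ := hM.prop.1.exists_adjoin hs
  refine mem_of _ N hN (fun z hz t => ?_) hMN hsN
  obtain ⟨p, -, q, -, h⟩ := hN.splits z hz _ (hMN (hXM t))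
  exact ⟨p, q, h⟩

/-- A Boolean subalgebra containing every element compatible with it is closed under joins of
orthogonal sequences. -/
theorem IsBooleanSubalgebra.isLUB_mem {M : Set L} (hM : IsBooleanSubalgebra M)
    (hL : IsSigmaOrthocomplete L) (hmax : ∀ s, (∀ b ∈ M, Compatible b s) → s ∈ M) {a : ℕ → L}
    (ha : ∀ n, a n ∈ M) (hd : ∀ n m, n ≠ m → a n ≤ (a m)ᶜ) {s : L}
    (hs : IsLUB (Set.range a) s) : s ∈ M := by
  refine hmax s fun b hb => Compatible.symm ?_
  choose p _ q _ h using fun n => hM.splits (a n) (ha n) b hb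
  obtain ⟨P, hP⟩ := hL p fun n m hnm =>
    (h n).left_le.trans ((hd n m hnm).trans (compl_anti' _ _ (h m).left_le))
  obtain ⟨Q, hQ⟩ := hL q fun n m hnm =>
    (h n).right_le.trans ((hd n m hnm).trans (compl_anti' _ _ (h m).right_le))
  rw [isLUB_iff_le_iff] at hP hQ hs
  simp only [mem_upperBounds, Set.forall_mem_range] at hP hQ hs
  refine ⟨P, Q, (hP b).2 fun n => (h n).le_left, (hQ _).2 fun n => (h n).le_right,
    isLUB_pair_iff.2 fun u => ?_⟩
  rw [hs, hP, hQ, ← forall_and]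
  exact forall_congr' fun n => (h n).le_iff u

end OrthomodularPoset

end OrthomodularPoset

/-! ### Observables as homomorphisms, and uniqueness. -/

section Observable

open OrthomodularPoset

variable {L : Type*} [OrthomodularPoset L]

namespace IsObservable

variable {x : BorelSet → L}

theorem isLUB_of_union (hx : IsObservable x) {E F G : BorelSet}
    (hd : Disjoint (E : Set ℝ) (F : Set ℝ)) (h : (G : Set ℝ) = E ∪ F) : IsLUB {x E, x F} (x G) := by
  have : G = ⟨(E : Set ℝ) ∪ (F : Set ℝ), E.2.union F.2⟩ := Subtype.ext h
  rw [this]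
  exact (hx.map_union E F hd).2

theorem mono (hx : IsObservable x) {E F : BorelSet} (h : (E : Set ℝ) ⊆ F) : x E ≤ x F := by
  have := hx.isLUB_of_union (E := E) (F := ⟨F \ E, F.2.diff E.2⟩) (G := F)
    Set.disjoint_sdiff_right (Set.union_sdiff_cancel h).symm
  exact ((isLUB_pair_iff.1 this _).1 le_rfl).1

theorem map_compl (hx : IsObservable x) (E : BorelSet) : x ⟨(E : Set ℝ)ᶜ, E.2.compl⟩ = (x E)ᶜ := by
  have hd : Disjoint (E : Set ℝ) (⟨(E : Set ℝ)ᶜ, E.2.compl⟩ : BorelSet) := disjoint_compl_right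
  have h := hx.isLUB_of_union (G := ⟨Set.univ, MeasurableSet.univ⟩) hd (Set.union_compl_self _).symm
  rw [hx.map_univ] at h
  exact (eq_compl_of_isLUB_top (hx.map_union _ _ hd).1 h).symm

theorem map_empty (hx : IsObservable x) : x ⟨∅, MeasurableSet.empty⟩ = ⊥ := by
  rw [← compl_top', ← hx.map_univ, ← hx.map_compl]
  exact congrArg x (Subtype.ext Set.compl_univ.symm)

theorem isLUB_union (hx : IsObservable x) {E F G : BorelSet} (h : (G : Set ℝ) = E ∪ F) :
    IsLUB {x E, x F} (x G) := by
  have h1 := isLUB_pair_iff.1 (hx.isLUB_of_union (E := E) (F := ⟨F \ E, F.2.diff E.2⟩) (G := G)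
    Set.disjoint_sdiff_right (by simp [h]))
  refine isLUB_pair_iff.2 fun u => ⟨fun hu => ⟨(hx.mono ?_).trans hu, (hx.mono ?_).trans hu⟩,
    fun hu => (h1 u).2 ⟨hu.1, (hx.mono ?_).trans hu.2⟩⟩
  · exact h ▸ Set.subset_union_left
  · exact h ▸ Set.subset_union_right
  · exact Set.sdiff_subset

theorem isLUB_iUnion (hx : IsObservable x) (E : ℕ → BorelSet) :
    IsLUB (Set.range fun i => x (E i)) (x (BorelSet.iUnion E)) := by
  let F : ℕ → BorelSet := fun n => Nat.rec (E 0)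
    (fun k G => ⟨(G : Set ℝ) ∪ (E (k + 1) : Set ℝ), G.2.union (E (k + 1)).2⟩) n
  have hEF : ∀ n, (E n : Set ℝ) ⊆ (F n).1 := by
    rintro (_ | n)
    · exact subset_rfl
    · exact Set.subset_union_right
  have hF : ∀ n, (F n).1 ⊆ (BorelSet.iUnion E : Set ℝ) := by
    intro n
    induction n with
    | zero => exact Set.subset_iUnion (fun n => (E n : Set ℝ)) 0
    | succ n ih => exact Set.union_subset ih (Set.subset_iUnion (fun n => (E n : Set ℝ)) (n + 1))
  have hFE : BorelSet.iUnion F = BorelSet.iUnion E :=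
    Subtype.ext (Set.Subset.antisymm (Set.iUnion_subset hF) (Set.iUnion_mono hEF))
  have h := hx.map_iUnion F fun i => Set.subset_union_left
  rw [hFE] at h
  refine ⟨?_, fun u hu => h.2 ?_⟩
  · rintro _ ⟨n, rfl⟩
    exact (hx.mono (hEF n)).trans (h.1 ⟨n, rfl⟩)
  · rintro _ ⟨n, rfl⟩
    change x (F n) ≤ u
    induction n with
    | zero => exact hu ⟨0, rfl⟩
    | succ n ih => exact (isLUB_pair_iff.1 (hx.isLUB_union rfl) u).2 ⟨ih, hu ⟨n + 1, rfl⟩⟩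

theorem isGLB_iInter (hx : IsObservable x) (E : ℕ → BorelSet) :
    IsGLB (Set.range fun i => x (E i)) (x (BorelSet.iInter E)) := by
  have h := hx.isLUB_iUnion fun n => ⟨(E n : Set ℝ)ᶜ, (E n).2.compl⟩
  have hE : BorelSet.iUnion (fun n => ⟨(E n : Set ℝ)ᶜ, (E n).2.compl⟩) =
      ⟨(BorelSet.iInter E : Set ℝ)ᶜ, (BorelSet.iInter E).2.compl⟩ :=
    Subtype.ext (Set.compl_iInter _).symm
  rw [hE, hx.map_compl, isLUB_iff_le_iff] at h
  simp only [hx.map_compl, mem_upperBounds, Set.forall_mem_range] at h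
  rw [isGLB_iff_le_iff]
  intro u
  simp only [mem_lowerBounds, Set.forall_mem_range]
  have := h uᶜ
  simp only [compl_le_compl_iff'] at this
  exact this

theorem isGLB_inter (hx : IsObservable x) {E F G : BorelSet} (h : (G : Set ℝ) = E ∩ F) :
    IsGLB {x E, x F} (x G) := by
  have h1 := isLUB_pair_iff.1 (hx.isLUB_union (E := ⟨(E : Set ℝ)ᶜ, E.2.compl⟩)
    (F := ⟨(F : Set ℝ)ᶜ, F.2.compl⟩) (G := ⟨(G : Set ℝ)ᶜ, G.2.compl⟩) (by simp [h, Set.compl_inter]))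
  rw [isGLB_iff_le_iff]
  intro u
  have := h1 uᶜ
  simp only [hx.map_compl, compl_le_compl_iff'] at this
  simpa [lowerBounds] using this

/-- Joins and meets of values are values at unions and intersections, so distributivity is that of
sets. -/
theorem isBooleanSigmaSubalgebra_range (hx : IsObservable x) :
    IsBooleanSigmaSubalgebra (Set.range x) where
  top_mem := ⟨_, hx.map_univ⟩
  compl_mem := by
    rintro _ ⟨E, rfl⟩
    exact ⟨_, hx.map_compl E⟩
  exists_isLUB := by
    intro a ha
    choose E hE using ha
    obtain rfl : (fun n => x (E n)) = a := funext hE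
    exact ⟨_, ⟨_, rfl⟩, hx.isLUB_iUnion E⟩
  distrib := by
    rintro _ ⟨E, rfl⟩ _ ⟨F, rfl⟩ _ ⟨G, rfl⟩ j m p q hj hm hp hq
    obtain rfl := hj.unique (hx.isLUB_union (G := ⟨F ∪ G, F.2.union G.2⟩) rfl)
    obtain rfl := hm.unique (hx.isGLB_inter (G := ⟨E ∩ (F ∪ G), E.2.inter (F.2.union G.2)⟩) rfl)
    obtain rfl := hp.unique (hx.isGLB_inter (G := ⟨E ∩ F, E.2.inter F.2⟩) rfl)
    obtain rfl := hq.unique (hx.isGLB_inter (G := ⟨E ∩ G, E.2.inter G.2⟩) rfl)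
    exact hx.isLUB_union (Set.inter_union_distrib_left _ _ _)

theorem isBooleanSigmaHom (hx : IsObservable x) : IsBooleanSigmaHom x where
  exists_subalgebra := ⟨_, hx.isBooleanSigmaSubalgebra_range, fun E => ⟨E, rfl⟩⟩
  map_empty := hx.map_empty
  map_univ := hx.map_univ
  map_compl := hx.map_compl
  map_iUnion := hx.isLUB_iUnion
  map_iInter := hx.isGLB_iInter

end IsObservable

/-- Induction principle for Borel subsets of `ℝ` generated from the half-lines `(-∞, t)`. -/
theorem BorelSet.induction {C : BorelSet → Prop} (empty : C ⟨∅, MeasurableSet.empty⟩)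
    (Iio : ∀ t, C (BorelSet.Iio t))
    (compl : ∀ E : BorelSet, C E → C ⟨(E : Set ℝ)ᶜ, E.2.compl⟩)
    (iUnion : ∀ E : ℕ → BorelSet, (∀ n m, n ≠ m → Disjoint (E n : Set ℝ) (E m : Set ℝ)) →
      (∀ n, C (E n)) → C (BorelSet.iUnion E)) (E : BorelSet) : C E := by
  obtain ⟨E, hE⟩ := E
  refine MeasurableSpace.induction_on_inter (C := fun E hE => C ⟨E, hE⟩)
    (s := Set.range (Set.Iio : ℝ → Set ℝ)) ?_ ?_ empty ?_ ?_ ?_ E hE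
  · rw [BorelSpace.measurable_eq (α := ℝ)]
    exact borel_eq_generateFrom_Iio ℝ
  · rintro _ ⟨s, rfl⟩ _ ⟨t, rfl⟩ -
    exact ⟨min s t, Set.Iio_inter_Iio.symm⟩
  · rintro _ ⟨t, rfl⟩
    exact Iio t
  · exact fun E hE h => compl ⟨E, hE⟩ h
  · exact fun f hd hf h => iUnion (fun n => ⟨f n, hf n⟩) (fun n m hnm => hd hnm) h

theorem IsObservable.ext_Iio {x y : BorelSet → L} (hx : IsObservable x) (hy : IsObservable y)
    (h : ∀ t, x (BorelSet.Iio t) = y (BorelSet.Iio t)) : x = y := by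
  funext E
  induction E using BorelSet.induction with
  | empty => rw [hx.map_empty, hy.map_empty]
  | Iio t => exact h t
  | compl E ih => rw [hx.map_compl, hy.map_compl, ih]
  | iUnion E _ ih =>
    have h1 := hx.isLUB_iUnion E
    simp only [ih] at h1
    exact h1.unique (hy.isLUB_iUnion E)

end Observable

/-! ### Generic sequences and the construction of the observable. -/

section Generic

open OrthomodularPoset

variable {L : Type*} [OrthomodularPoset L]

/-- `D` is dense in the nonzero part of `M`. -/
def IsDenseBelow (M D : Set L) : Prop :=
  ∀ k ∈ M, k ≠ ⊥ → ∃ k' ∈ M, k' ≠ ⊥ ∧ k' ≤ k ∧ k' ∈ D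

/-- A decreasing sequence of nonzero elements meeting every member of `𝒟`. -/
structure IsGeneric (𝒟 : Set (Set L)) (g : ℕ → L) : Prop where
  antitone : Antitone g
  ne_bot : ∀ n, g n ≠ ⊥
  exists_mem : ∀ D ∈ 𝒟, ∃ n, g n ∈ D

/-- The element `m` belongs to the filter generated by the sequence `g`. -/
def Forces (g : ℕ → L) (m : L) : Prop := ∃ n, g n ≤ m

theorem Forces.mono {g : ℕ → L} {a b : L} (h : Forces g a) (hab : a ≤ b) : Forces g b :=
  h.imp fun _ hn => hn.trans hab

/-- The Rasiowa–Sikorski lemma. -/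
theorem exists_isGeneric {M : Set L} {𝒟 : Set (Set L)} (hc : 𝒟.Countable)
    (hd : ∀ D ∈ 𝒟, IsDenseBelow M D) {k : L} (hk : k ∈ M) (hk0 : k ≠ ⊥) :
    ∃ g, IsGeneric 𝒟 g ∧ g 0 = k := by
  rcases 𝒟.eq_empty_or_nonempty with rfl | hne
  · exact ⟨fun _ => k, ⟨antitone_const, fun _ => hk0, by simp⟩, rfl⟩
  obtain ⟨D, rfl⟩ := hc.exists_eq_range hne
  have hstep : ∀ (n : ℕ) (p : {k : L // k ∈ M ∧ k ≠ ⊥}), ∃ p' : {k : L // k ∈ M ∧ k ≠ ⊥},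
      (p' : L) ≤ p ∧ (p' : L) ∈ D n := by
    rintro n ⟨p, hp, hp0⟩
    obtain ⟨p', h1, h2, h3, h4⟩ := hd (D n) ⟨n, rfl⟩ p hp hp0
    exact ⟨⟨p', h1, h2⟩, h3, h4⟩
  choose f hf using hstep
  let g : ℕ → {k : L // k ∈ M ∧ k ≠ ⊥} := fun n => Nat.rec ⟨k, hk, hk0⟩ f n
  refine ⟨fun n => (g n).1,
    ⟨antitone_nat_of_succ_le fun n => (hf n (g n)).1, fun n => (g n).2.2, ?_⟩, rfl⟩
  rintro _ ⟨n, rfl⟩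
  exact ⟨n + 1, (hf n (g n)).2⟩

namespace IsGeneric

variable {𝒟 : Set (Set L)} {g : ℕ → L}

theorem subset {𝒟' : Set (Set L)} (hg : IsGeneric 𝒟 g) (h : 𝒟' ⊆ 𝒟) : IsGeneric 𝒟' g :=
  ⟨hg.antitone, hg.ne_bot, fun D hD => hg.exists_mem D (h hD)⟩

theorem not_forces_orthogonal (hg : IsGeneric 𝒟 g) {a b : L} (hab : a ≤ bᶜ) (ha : Forces g a) :
    ¬ Forces g b := by
  rintro ⟨n, hn⟩
  obtain ⟨k, hk⟩ := ha
  refine hg.ne_bot (max k n) (eq_bot_of_le_of_le_compl ((hg.antitone (le_max_right k n)).trans hn) ?_)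
  exact ((hg.antitone (le_max_left k n)).trans hk).trans hab

end IsGeneric

/-- The elements deciding which member of `A` lies above the generic sequence, if its join `s`
does. -/
def supDense (A : Set L) (s : L) : Set L := {k | (∃ a ∈ A, k ≤ a) ∨ k ≤ sᶜ}

/-- The elements deciding `m`. -/
def decideDense (m : L) : Set L := {k | k ≤ m ∨ k ≤ mᶜ}

theorem isDenseBelow_decideDense {M : Set L} (hM : IsBooleanSubalgebra M) {m : L} (hm : m ∈ M) :
    IsDenseBelow M (decideDense m) := by
  intro k hk hk0
  obtain ⟨p, hp, q, hq, h⟩ := hM.splits k hk m hm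
  by_cases hp0 : p = ⊥
  · refine ⟨k, hk, hk0, le_rfl, Or.inr ?_⟩
    exact h.le_compl_of_orthogonal le_rfl (by simp [hp0, compl_bot'])
  · exact ⟨p, hp, hp0, h.left_le, Or.inl h.le_left⟩

/-- Either some nonzero part of `k` in `M` lies below a member of `A`, or `k` is orthogonal to all
of `A` and therefore to its join in `L`. -/
theorem isDenseBelow_supDense {M : Set L} (hM : IsBooleanSubalgebra M) {A : Set L} {s : L}
    (hs : IsLUB A s) (hA : A ⊆ M) : IsDenseBelow M (supDense A s) := by
  intro k hk hk0
  by_cases h : ∃ a ∈ A, ∃ p ∈ M, p ≠ ⊥ ∧ p ≤ k ∧ p ≤ a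
  · obtain ⟨a, ha, p, hp, hp0, hpk, hpa⟩ := h
    exact ⟨p, hp, hp0, hpk, Or.inl ⟨a, ha, hpa⟩⟩
  · push Not at h
    refine ⟨k, hk, hk0, le_rfl, Or.inr (le_compl_comm.1 (hs.2 fun a ha => le_compl_comm.1 ?_))⟩
    obtain ⟨p, hp, q, hq, hs⟩ := hM.splits k hk a (hA ha)
    refine hs.le_compl_of_orthogonal le_rfl ?_
    have : p = ⊥ := by
      by_contra hp0
      exact h a ha p hp hp0 hs.left_le hs.le_left
    simp [this, compl_bot']

theorem IsGeneric.forces_compl_iff {𝒟 : Set (Set L)} {g : ℕ → L} (hg : IsGeneric 𝒟 g) {m : L}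
    (hm : decideDense m ∈ 𝒟) : Forces g mᶜ ↔ ¬ Forces g m := by
  refine ⟨fun h => hg.not_forces_orthogonal le_rfl h, fun h => ?_⟩
  obtain ⟨n, hn | hn⟩ := hg.exists_mem _ hm
  · exact absurd ⟨n, hn⟩ h
  · exact ⟨n, hn⟩

theorem IsGeneric.forces_isLUB_iff {𝒟 : Set (Set L)} {g : ℕ → L} (hg : IsGeneric 𝒟 g) {A : Set L}
    {s : L} (hs : IsLUB A s) (hA : supDense A s ∈ 𝒟) : Forces g s ↔ ∃ a ∈ A, Forces g a := by
  constructor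
  · intro h
    obtain ⟨n, ⟨a, ha, hn⟩ | hn⟩ := hg.exists_mem _ hA
    · exact ⟨a, ha, n, hn⟩
    · exact absurd ⟨n, hn⟩ (hg.not_forces_orthogonal (by rw [compl_compl']) h)
  · rintro ⟨a, ha, h⟩
    exact h.mono (hs.1 ha)

/-- The real number `r` is the value of the spectral system `X` at the generic sequence `g`. -/
def IsGenericValue (X : ℝ → L) (g : ℕ → L) (r : ℝ) : Prop := ∀ q : ℚ, Forces g (X q) ↔ r < q

/-- `E` is represented by `m ∈ M`: for all sufficiently generic sequences, the generic real lies in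
`E` iff `m` is forced. -/
def Represents (M : Set L) (X : ℝ → L) (E : Set ℝ) (m : L) : Prop :=
  m ∈ M ∧ ∃ 𝒟 : Set (Set L), 𝒟.Countable ∧ (∀ D ∈ 𝒟, IsDenseBelow M D) ∧
    ∀ g, IsGeneric 𝒟 g → ∀ r, IsGenericValue X g r → (r ∈ E ↔ Forces g m)

namespace Represents

variable {M : Set L} {X : ℝ → L} {E F : Set ℝ} {m m' : L}

theorem compl (hM : IsBooleanSubalgebra M) (h : Represents M X E m) : Represents M X Eᶜ mᶜ := by
  obtain ⟨hm, 𝒟, hc, hd, h⟩ := h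
  refine ⟨hM.compl_mem m hm, insert (decideDense m) 𝒟, hc.insert _, ?_, fun g hg r hr => ?_⟩
  · rintro D (rfl | hD)
    · exact isDenseBelow_decideDense hM hm
    · exact hd D hD
  · rw [hg.forces_compl_iff (Set.mem_insert _ _), Set.mem_compl_iff,
      h g (hg.subset (Set.subset_insert _ _)) r hr]

theorem empty (hM : IsBooleanSubalgebra M) : Represents M X ∅ ⊥ := by
  refine ⟨?_, ∅, Set.countable_empty, by simp, fun g hg r _ => ?_⟩
  · rw [← compl_top']
    exact hM.compl_mem _ hM.top_mem
  · simp only [Set.mem_empty_iff_false, false_iff]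
    rintro ⟨n, hn⟩
    exact hg.ne_bot n (le_bot_iff.1 hn)

theorem iUnion (hM : IsBooleanSubalgebra M) {E : ℕ → Set ℝ} {a : ℕ → L} {s : L}
    (h : ∀ n, Represents M X (E n) (a n)) (hs : IsLUB (Set.range a) s) (hsM : s ∈ M) :
    Represents M X (⋃ n, E n) s := by
  choose ha 𝒟 hc hd h using h
  refine ⟨hsM, insert (supDense (Set.range a) s) (⋃ n, 𝒟 n), (Set.countable_iUnion hc).insert _,
    ?_, fun g hg r hr => ?_⟩
  · rintro D (rfl | hD)
    · exact isDenseBelow_supDense hM hs (Set.range_subset_iff.2 ha)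
    · obtain ⟨n, hn⟩ := Set.mem_iUnion.1 hD
      exact hd n D hn
  · rw [hg.forces_isLUB_iff hs (Set.mem_insert _ _), Set.mem_iUnion, Set.exists_range_iff]
    refine exists_congr fun n => h n g (hg.subset ?_) r hr
    exact (Set.subset_iUnion 𝒟 n).trans (Set.subset_insert _ _)

end Represents

namespace IsSpectralSystem

variable {M : Set L} {X : ℝ → L}

theorem monotone (hX : IsSpectralSystem X) : Monotone X := fun s t h => by
  rcases h.eq_or_lt with rfl | h
  · exact le_rfl
  · exact hX.mono _ _ h

theorem isLUB_rat (hX : IsSpectralSystem X) (t : ℝ) :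
    IsLUB ((fun q : ℚ => X q) '' {q | (q : ℝ) < t}) (X t) := by
  refine ⟨?_, fun u hu => (hX.isLUB_left t).2 ?_⟩
  · rintro _ ⟨q, hq, rfl⟩
    exact hX.mono _ _ hq
  · rintro _ ⟨s, hs, rfl⟩
    obtain ⟨q, hsq, hqt⟩ := exists_rat_btwn (Set.mem_Iio.1 hs)
    exact (hX.mono _ _ hsq).trans (hu ⟨q, hqt, rfl⟩)

theorem isLUB_range_rat (hX : IsSpectralSystem X) : IsLUB (Set.range fun q : ℚ => X q) ⊤ := by
  refine ⟨fun _ _ => le_top, fun u hu => hX.isLUB_top.2 ?_⟩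
  rintro _ ⟨s, rfl⟩
  obtain ⟨q, hq⟩ := exists_rat_gt s
  exact (hX.mono _ _ hq).trans (hu ⟨q, rfl⟩)

theorem isLUB_range_compl_rat (hX : IsSpectralSystem X) :
    IsLUB (Set.range fun q : ℚ => (X q)ᶜ) ⊤ := by
  refine ⟨fun _ _ => le_top, fun u hu => ?_⟩
  rw [← compl_bot', compl_le_comm]
  refine hX.isGLB_bot.2 ?_
  rintro _ ⟨s, rfl⟩
  obtain ⟨q, hq⟩ := exists_rat_lt s
  exact (compl_le_comm.1 (hu ⟨q, rfl⟩)).trans (hX.mono _ _ hq)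

/-- The dense sets that ensure that a generic sequence has a real value. -/
def valueDense (X : ℝ → L) : Set (Set L) :=
  {supDense (Set.range fun q : ℚ => X q) ⊤, supDense (Set.range fun q : ℚ => (X q)ᶜ) ⊤} ∪
    Set.range fun t : ℚ => supDense ((fun q : ℚ => X q) '' {q | (q : ℝ) < (t : ℝ)}) (X t)

theorem countable_valueDense (X : ℝ → L) : (valueDense X).Countable :=
  ((Set.toFinite _).countable).union (Set.countable_range _)

theorem isDenseBelow_valueDense (hX : IsSpectralSystem X) (hM : IsBooleanSubalgebra M)
    (hXM : ∀ t, X t ∈ M) : ∀ D ∈ valueDense X, IsDenseBelow M D := by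
  rintro D ((rfl | rfl) | ⟨t, rfl⟩)
  · exact isDenseBelow_supDense hM hX.isLUB_range_rat (Set.range_subset_iff.2 fun q => hXM q)
  · exact isDenseBelow_supDense hM hX.isLUB_range_compl_rat
      (Set.range_subset_iff.2 fun q => hM.compl_mem _ (hXM q))
  · exact isDenseBelow_supDense hM (hX.isLUB_rat t) (Set.image_subset_iff.2 fun q _ => hXM q)

/-- The value is the infimum of the rationals `q` with `X q` forced. The top joins make this set
nonempty and bounded below; left continuity means it has no least element, which gives the strict
inequality. -/
theorem exists_isGenericValue (hX : IsSpectralSystem X) {g : ℕ → L}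
    (hg : IsGeneric (valueDense X) g) : ∃ r, IsGenericValue X g r := by
  have htop : Forces g ⊤ := ⟨0, le_top⟩
  obtain ⟨_, ⟨q₁, rfl⟩, h₁⟩ := (hg.forces_isLUB_iff hX.isLUB_range_rat
    (Or.inl (Or.inl rfl))).1 htop
  obtain ⟨_, ⟨q₀, rfl⟩, h₀⟩ := (hg.forces_isLUB_iff hX.isLUB_range_compl_rat
    (Or.inl (Or.inr rfl))).1 htop
  let S : Set ℝ := {s | ∃ q : ℚ, (q : ℝ) = s ∧ Forces g (X q)}
  have hbdd : BddBelow S := by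
    refine ⟨q₀, ?_⟩
    rintro _ ⟨q, rfl, hq⟩
    by_contra! h
    exact hg.not_forces_orthogonal le_rfl h₀ (hq.mono (hX.mono _ _ h))
  refine ⟨sInf S, fun q => ⟨fun hq => ?_, fun hq => ?_⟩⟩
  · obtain ⟨_, ⟨q', hq', rfl⟩, h'⟩ := (hg.forces_isLUB_iff (hX.isLUB_rat q) (Or.inr ⟨q, rfl⟩)).1 hq
    exact (csInf_le hbdd ⟨q', rfl, h'⟩).trans_lt hq'
  · obtain ⟨_, ⟨q', rfl, h'⟩, hq'⟩ := exists_lt_of_csInf_lt (⟨_, q₁, rfl, h₁⟩ : S.Nonempty) hq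
    exact h'.mono (hX.mono _ _ hq')

theorem represents_Iio (hX : IsSpectralSystem X) (hM : IsBooleanSubalgebra M)
    (hXM : ∀ t, X t ∈ M) (t : ℝ) : Represents M X (Set.Iio t) (X t) := by
  refine ⟨hXM t, {supDense ((fun q : ℚ => X q) '' {q | (q : ℝ) < t}) (X t)},
    Set.countable_singleton _, ?_, fun g hg r hr => ?_⟩
  · rintro _ rfl
    exact isDenseBelow_supDense hM (hX.isLUB_rat t) (Set.image_subset_iff.2 fun q _ => hXM q)
  · rw [hg.forces_isLUB_iff (hX.isLUB_rat t) rfl, Set.exists_mem_image]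
    constructor
    · intro h
      obtain ⟨q, hrq, hqt⟩ := exists_rat_btwn (Set.mem_Iio.1 h)
      exact ⟨q, hqt, (hr q).2 hrq⟩
    · rintro ⟨q, hqt, hq⟩
      exact ((hr q).1 hq).trans hqt

/-- If `m ∧ m'` were nonzero, a generic sequence starting there would have its value in both `E` and
`F`. -/
theorem orthogonal_of_represents (hX : IsSpectralSystem X) (hM : IsBooleanSubalgebra M)
    (hXM : ∀ t, X t ∈ M) {E F : Set ℝ} {m m' : L} (hE : Represents M X E m)
    (hF : Represents M X F m') (hEF : Disjoint E F) : m ≤ m'ᶜ := by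
  obtain ⟨hm, 𝒟, hc, hd, h⟩ := hE
  obtain ⟨hm', 𝒟', hc', hd', h'⟩ := hF
  obtain ⟨p, hp, q, hq, hs⟩ := hM.splits m hm m' hm'
  refine hs.le_compl_of_orthogonal le_rfl ?_
  by_cases hp0 : p = ⊥
  · simp [hp0, compl_bot']
  obtain ⟨g, hg, hg0⟩ := exists_isGeneric (M := M)
    ((hc.union hc').union (countable_valueDense X)) (by
      rintro D ((hD | hD) | hD)
      · exact hd D hD
      · exact hd' D hD
      · exact hX.isDenseBelow_valueDense hM hXM D hD) hp hp0
  obtain ⟨r, hr⟩ := hX.exists_isGenericValue (hg.subset Set.subset_union_right)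
  have hrE : r ∈ E := (h g (hg.subset fun D hD => Or.inl (Or.inl hD)) r hr).2
    ⟨0, hg0 ▸ hs.left_le⟩
  have hrF : r ∈ F := (h' g (hg.subset fun D hD => Or.inl (Or.inr hD)) r hr).2
    ⟨0, hg0 ▸ hs.le_left⟩
  exact absurd hrF (Set.disjoint_left.1 hEF hrE)

theorem represents_unique (hX : IsSpectralSystem X) (hM : IsBooleanSubalgebra M)
    (hXM : ∀ t, X t ∈ M) {E : Set ℝ} {m m' : L} (h : Represents M X E m)
    (h' : Represents M X E m') : m = m' := by
  have key : ∀ {m m' : L}, Represents M X E m → Represents M X E m' → m ≤ m' := by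
    intro m m' h h'
    have := hX.orthogonal_of_represents hM hXM h (h'.compl hM) disjoint_compl_right
    rwa [compl_compl'] at this
  exact le_antisymm (key h h') (key h' h)

theorem exists_isObservable (hL : IsSigmaOrthocomplete L) (hX : IsSpectralSystem X) :
    ∃ x : BorelSet → L, IsObservable x ∧ ∀ t, x (BorelSet.Iio t) = X t := by
  obtain ⟨M, hM, hXM, hmax⟩ := exists_isBooleanSubalgebra_of_chain hX.monotone
  -- Disjointness makes the representatives orthogonal, so their join exists in `L` and stays in
  -- `M`.
  have iUnion_aux : ∀ (E : ℕ → Set ℝ) (a : ℕ → L), (∀ n m, n ≠ m → Disjoint (E n) (E m)) →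
      (∀ n, Represents M X (E n) (a n)) →
      ∃ s, IsLUB (Set.range a) s ∧ Represents M X (⋃ n, E n) s := by
    intro E a hd h
    have horth : ∀ n m, n ≠ m → a n ≤ (a m)ᶜ := fun n m hnm =>
      hX.orthogonal_of_represents hM hXM (h n) (h m) (hd n m hnm)
    obtain ⟨s, hs⟩ := hL a horth
    exact ⟨s, hs, .iUnion hM h hs (hM.isLUB_mem hL hmax (fun n => (h n).1) horth hs)⟩
  have hex : ∀ E : BorelSet, ∃ m, Represents M X E m := by
    intro E
    induction E using BorelSet.induction with
    | empty => exact ⟨⊥, .empty hM⟩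
    | Iio t => exact ⟨X t, hX.represents_Iio hM hXM t⟩
    | compl E ih =>
      obtain ⟨m, h⟩ := ih
      exact ⟨mᶜ, h.compl hM⟩
    | iUnion E hd ih =>
      choose a ha using ih
      obtain ⟨s, -, hs⟩ := iUnion_aux _ a hd ha
      exact ⟨s, hs⟩
  choose x hx using hex
  have eq_of : ∀ (E : BorelSet) {m}, Represents M X E m → x E = m := fun E m h =>
    hX.represents_unique hM hXM (hx E) h
  have isLUB_iUnion : ∀ E : ℕ → BorelSet,
      (∀ n m, n ≠ m → Disjoint (E n : Set ℝ) (E m : Set ℝ)) →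
      IsLUB (Set.range fun n => x (E n)) (x (BorelSet.iUnion E)) := by
    intro E hd
    obtain ⟨s, hs, h⟩ := iUnion_aux _ _ hd fun n => hx (E n)
    rwa [eq_of (BorelSet.iUnion E) h]
  have hempty : x ⟨∅, MeasurableSet.empty⟩ = ⊥ := eq_of _ (.empty hM)
  have map_union : ∀ E F : BorelSet, Disjoint (E : Set ℝ) (F : Set ℝ) →
      IsOrthoSum (x E) (x F) (x ⟨(E : Set ℝ) ∪ (F : Set ℝ), E.2.union F.2⟩) := by
    intro E F hd
    refine ⟨hX.orthogonal_of_represents hM hXM (hx E) (hx F) hd, ?_⟩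
    let f : ℕ → BorelSet
      | 0 => E
      | 1 => F
      | _ + 2 => ⟨∅, MeasurableSet.empty⟩
    have hf : BorelSet.iUnion f = ⟨(E : Set ℝ) ∪ (F : Set ℝ), E.2.union F.2⟩ := by
      refine Subtype.ext (Set.Subset.antisymm (Set.iUnion_subset ?_) (Set.union_subset ?_ ?_))
      · rintro (_ | _ | n)
        · exact Set.subset_union_left
        · exact Set.subset_union_right
        · exact Set.empty_subset _
      · exact Set.subset_iUnion (fun n => (f n : Set ℝ)) 0
      · exact Set.subset_iUnion (fun n => (f n : Set ℝ)) 1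
    have h := isLUB_iUnion f (by
      rintro (_ | _ | n) (_ | _ | m) hnm
      all_goals first
        | exact absurd rfl hnm
        | exact hd
        | exact hd.symm
        | exact Set.disjoint_empty _
        | exact Set.empty_disjoint _)
    rw [hf] at h
    refine ⟨?_, fun u hu => h.2 ?_⟩
    · rintro _ (rfl | rfl)
      · exact h.1 ⟨0, rfl⟩
      · exact h.1 ⟨1, rfl⟩
    · rintro _ ⟨_ | _ | n, rfl⟩
      · exact hu (Or.inl rfl)
      · exact hu (Or.inr rfl)
      · exact hempty.trans_le bot_le
  have mono : ∀ E F : BorelSet, (E : Set ℝ) ⊆ F → x E ≤ x F := by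
    intro E F h
    have h1 := (map_union E ⟨F \ E, F.2.diff E.2⟩ Set.disjoint_sdiff_right).2
    have h2 : (⟨(E : Set ℝ) ∪ (F \ E), E.2.union (F.2.diff E.2)⟩ : BorelSet) = F :=
      Subtype.ext (Set.union_sdiff_cancel h)
    rw [h2] at h1
    exact h1.1 (Or.inl rfl)
  refine ⟨x, ⟨?_, map_union, fun E _ => ?_⟩, fun t => eq_of _ (hX.represents_Iio hM hXM t)⟩
  · refine eq_of _ ?_
    have h := Represents.compl (X := X) hM (.empty hM)
    rwa [compl_bot', Set.compl_empty] at h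
  -- Continuity reduces to the disjoint case by disjointification.
  · let F : ℕ → BorelSet := fun n => ⟨disjointed (fun n => (E n : Set ℝ)) n,
      MeasurableSet.disjointed (fun n => (E n).2) n⟩
    have h := isLUB_iUnion F fun n m hnm =>
      disjoint_disjointed (fun n => (E n : Set ℝ)) hnm
    have hF : BorelSet.iUnion F = BorelSet.iUnion E := Subtype.ext iUnion_disjointed
    rw [hF] at h
    refine ⟨?_, fun u hu => h.2 ?_⟩
    · rintro _ ⟨n, rfl⟩
      exact mono _ _ (Set.subset_iUnion (fun n => (E n : Set ℝ)) n)
    · rintro _ ⟨n, rfl⟩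
      exact (mono _ _ (disjointed_subset (fun n => (E n : Set ℝ)) n)).trans (hu ⟨n, rfl⟩)

end IsSpectralSystem

end Generic

theorem theorem3p8 {L : Type*} [OrthomodularPoset L] (hL : IsSigmaOrthocomplete L) :
    (∀ X : ℝ → L, IsSpectralSystem X →
      ∃ x : BorelSet → L, IsObservable x ∧ IsBooleanSigmaHom x ∧
        (∀ t : ℝ, x (BorelSet.Iio t) = X t) ∧
        ∀ y : BorelSet → L, IsObservable y → (∀ t : ℝ, y (BorelSet.Iio t) = X t) → y = x) ∧
    (∀ x : BorelSet → L, IsObservable x → IsBooleanSigmaHom x) := by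
  refine ⟨fun X hX => ?_, fun x hx => hx.isBooleanSigmaHom⟩
  obtain ⟨x, hx, hxX⟩ := hX.exists_isObservable hL
  exact ⟨x, hx, hx.isBooleanSigmaHom, hxX, fun y hy hyX =>
    hy.ext_Iio hx fun t => (hyX t).trans (hxX t).symm⟩
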